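/- Let $\Sigma=\{a,b\}$ and $L_1=\{(a^mb^m)^n : m,n\in\mathbb N,\ m,n\ge 1\}\subseteq\Sigma^*$. For $w\in\Sigma^*$ let $|w|_x$ be the number of occurrences of the letter $x$ in $w$. A set $A\subseteq\mathbb N_0^d$ is *linear* if $A=\{v_0+\alpha_1v_1+\dots+\alpha_rv_r : \alpha_1,\dots,\alpha_r\in\mathbb N_0\}$ for some $r\ge 0$ and $v_0,\dots,v_r\in\mathbb N_0^d$, and *semi-linear* if it is a finite union of linear sets. The *Parikh image* of $L\subseteq\Sigma^*$ is $\{(|w|_a,|w|_b) : w\in L\}\subseteq\mathbb N_0^2$. A *multiple context-free grammar* over $\Sigma$ consists of a finite set of non-terminals, each with a rank (its number of arguments), a start non-terminal $S$ of rank $1$, and a finite set of rules $$A(s_1,\dots,s_m)\leftarrow B_1(x^1_1,\dots,x^1_{k_1}),\dots,B_n(x^n_1,\dots,x^n_{k_n}),\qquad n\ge 0,$$ where $A,B_1,\dots,B_n$ are non-terminals of ranks $m,k_1,\dots,k_n$, the variables $x^i_j$ are distinct, and $s_1,\dots,s_m$ are strings of terminals and of variables $x^i_j$ such that each variable occurs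 at most once in the concatenation $s_1\cdots s_m$. Such a rule allows one to obtain, from tuples of words already obtained as values of $B_1,\dots,B_n$, the value of $A$ that results from putting these words for the variables in $(s_1,\dots,s_m)$. The language of the grammar is the set of all $w\in\Sigma^*$ such that $(w)$ can be obtained as a value of $S$ by finitely many applications of rules. A language is *$k$-multiple context-free* if it is the language of such a grammar in which every rank is at most $k$, and *multiple context-free* if it is $k$-multiple context-free for some integer $k\ge 1$. **Lemma 5.2.** The Parikh image of $L_1$ is semi-linear, and in fact linear; but $L_1$ is not multiple context-free. -/

import Mathlib

/-- A rule `A(s₁, …, s_m) ← B₁(x¹₁, …), …, B_n(xⁿ₁, …)` of a multiple context-free grammar with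
terminals `T` and non-terminals `N`, where `rank A` is the number of arguments of `A`.
The variable `xⁱ_j` is the pair `⟨i, j⟩`. A rule with `arity = 0` is an initialising rule
`A(t₁, …, t_m) ←`. -/
structure MCFRule (T : Type*) {N : Type*} (rank : N → ℕ) where
  /-- The non-terminal `A` on the left. -/
  lhs : N
  /-- The number `n` of non-terminals on the right. -/
  arity : ℕ
  /-- The non-terminals `B₁, …, B_n` on the right (repetitions allowed). -/
  rhs : Fin arity → N
  /-- The strings `s₁, …, s_m` of terminals and variables. -/
  out : Fin (rank lhs) → List (T ⊕ (Σ i : Fin arity, Fin (rank (rhs i))))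
  /-- Every variable occurs at most once in the concatenation `s₁ ⋯ s_m`. -/
  linear : ((List.ofFn out).flatten.filterMap Sum.getRight?).Nodup

/-- The value of a string of terminals and variables when words are put for the variables. -/
def MCFRule.subst {T V : Type*} (v : V → List T) (s : List (T ⊕ V)) : List T :=
  s.flatMap (Sum.elim (fun t => [t]) v)

/-- A multiple context-free grammar over the alphabet `T`: finitely many ranked non-terminals,
finitely many rules, and a start symbol of rank 1. -/
structure MCFGrammar (T : Type*) where
  /-- The non-terminals. -/
  NT : Type
  /-- There are finitely many non-terminals. -/
  finite_NT : Finite NT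
  /-- The rank (number of arguments) of each non-terminal. -/
  rank : NT → ℕ
  /-- The rules. -/
  rules : Set (MCFRule T rank)
  /-- There are finitely many rules. -/
  finite_rules : rules.Finite
  /-- The start symbol. -/
  start : NT
  /-- The start symbol has rank 1. -/
  rank_start : rank start = 1

/-- `G.Derives A u`: the tuple of words `u` can be obtained as a value of the non-terminal `A` by a
finite sequence of rules. -/
inductive MCFGrammar.Derives {T : Type*} (G : MCFGrammar T) :
    (A : G.NT) → (Fin (G.rank A) → List T) → Prop
  | rule (r : MCFRule T G.rank) (hr : r ∈ G.rules)
      (v : (i : Fin r.arity) → Fin (G.rank (r.rhs i)) → List T)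
      (hv : ∀ i, MCFGrammar.Derives G (r.rhs i) (v i)) :
      MCFGrammar.Derives G r.lhs (fun j => MCFRule.subst (fun x => v x.1 x.2) (r.out j))

/-- The language of a grammar: all words `w` for which `S(w)` can be obtained. -/
def MCFGrammar.language {T : Type*} (G : MCFGrammar T) : Language T :=
  {w | G.Derives G.start (fun _ => w)}

/-- `L` is `k`-multiple context-free: it is the language of a grammar all of whose non-terminals
have rank at most `k`. -/
def Language.IsKMultipleContextFree {T : Type*} (k : ℕ) (L : Language T) : Prop :=
  ∃ G : MCFGrammar T, (∀ A, G.rank A ≤ k) ∧ G.language = L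

/-- `L` is multiple context-free: it is `k`-multiple context-free for some `k ≥ 1`. -/
def Language.IsMultipleContextFree {T : Type*} (L : Language T) : Prop :=
  ∃ k : ℕ, 1 ≤ k ∧ L.IsKMultipleContextFree k

/-- The Parikh map `w ↦ (|w|_x)_x`, counting the occurrences of every letter. -/
def parikh {T : Type*} [DecidableEq T] (w : List T) : T → ℕ :=
  fun x => w.count x

/-- The Parikh image of a language. -/
def Language.parikhImage {T : Type*} [DecidableEq T] (L : Language T) : Set (T → ℕ) :=
  {p | ∃ w ∈ L, parikh w = p}

/-- The two-letter alphabet `{a, b}`. -/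
inductive AB
  | a
  | b
  deriving DecidableEq

/-- The language `L₁ = {(a^m b^m)^n | m, n ≥ 1}`. -/
def languageL1 : Language AB :=
  {w | ∃ m n : ℕ, 1 ≤ m ∧ 1 ≤ n ∧
    w = (List.replicate n (List.replicate m AB.a ++ List.replicate m AB.b)).flatten}

/-!
The Parikh image of `languageL1` is `{(c, c) | c ≥ 1}`, which is linear.

Suppose that `languageL1` is generated by a grammar all of whose ranks are at most `k`. Take
`n = k + 1` and look at derivations of `w = (a^m b^m)^n` for large `m`. A subtree of such a
derivation contributes at most `k` factors to `w`; the rest of `w` forms its context. These factors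
have at most `2 * k` ends, and `w` has `2 * n` blocks, so some block lies completely in the context
or completely in the factors (`blockWord.containsBlock_or_le_weight`).

If the context contains a whole block, exchange the words in it for other values of the same
non-terminal, the empty words being exchanged for empty words only. The block stays a factor, so the
result is a word `(a^m' b^m')^n'` with `m' ≥ m`. If in addition the new words act in the same way on
a finite automaton that counts the factors `ab` modulo `n + 1`, then `n' ≡ n` modulo `n + 1`, hence
`n' ≥ n`, and so the new words are at least as long in total
(`blockWord.weight_le_of_containsBlock`). As there are finitely many non-terminals and finitely many
actions on the automaton, the length of what is inserted into a context with a whole block is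
bounded by a constant `C` that does not depend on `m` (`MCFGrammar.exists_weight_bound`).

For `m` large compared to `C` and the rules, it follows by induction on the derivation that every
context contains a whole block (`MCFGrammar.containsBlock_of_derives`): the children of a subtree
contribute at most `C` letters each, so the subtree contributes fewer than `m` letters and cannot
contain a block. This is absurd for the root, whose context has no letters.
-/

/-! ### Strings of terminals and variables -/

namespace LinearContext

variable {T V W : Type*}

/-- The variables of a string of terminals and variables, from left to right. -/
def vars (s : List (T ⊕ V)) : List V := s.filterMap Sum.getRight?

/-- The total length of the words that are put for the variables of `s`. -/
def weight (u : V → List T) (s : List (T ⊕ V)) : ℕ :=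
  ((vars s).map fun x => (u x).length).sum

/-- The word obtained from `s` by putting `u` for the variables, every letter being marked with
`true` if it comes from `u` and with `false` if it is a terminal of `s`. -/
def marked (u : V → List T) (s : List (T ⊕ V)) : List (T × Bool) :=
  s.flatMap (Sum.elim (fun t => [(t, false)]) fun x => (u x).map fun t => (t, true))

@[simp] lemma vars_nil : vars ([] : List (T ⊕ V)) = [] := rfl

@[simp] lemma vars_inl (t : T) (s : List (T ⊕ V)) : vars (Sum.inl t :: s) = vars s := rfl

@[simp] lemma vars_inr (x : V) (s : List (T ⊕ V)) : vars (Sum.inr x :: s) = x :: vars s := rfl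

@[simp] lemma vars_append (s t : List (T ⊕ V)) : vars (s ++ t) = vars s ++ vars t :=
  List.filterMap_append

@[simp] lemma weight_nil (u : V → List T) : weight u [] = 0 := rfl

@[simp] lemma weight_inl (u : V → List T) (t : T) (s : List (T ⊕ V)) :
    weight u (Sum.inl t :: s) = weight u s := rfl

@[simp] lemma weight_inr (u : V → List T) (x : V) (s : List (T ⊕ V)) :
    weight u (Sum.inr x :: s) = (u x).length + weight u s := by
  simp [weight]

@[simp] lemma marked_nil (u : V → List T) : marked u [] = [] := rfl

@[simp] lemma marked_inl (u : V → List T) (t : T) (s : List (T ⊕ V)) :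
    marked u (Sum.inl t :: s) = (t, false) :: marked u s := rfl

@[simp] lemma marked_inr (u : V → List T) (x : V) (s : List (T ⊕ V)) :
    marked u (Sum.inr x :: s) = (u x).map (fun t => (t, true)) ++ marked u s := by
  simp [marked]

@[simp] lemma subst_nil (u : V → List T) : MCFRule.subst u [] = [] := rfl

@[simp] lemma subst_inl (u : V → List T) (t : T) (s : List (T ⊕ V)) :
    MCFRule.subst u (Sum.inl t :: s) = t :: MCFRule.subst u s := rfl

@[simp] lemma subst_inr (u : V → List T) (x : V) (s : List (T ⊕ V)) :
    MCFRule.subst u (Sum.inr x :: s) = u x ++ MCFRule.subst u s := by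
  simp [MCFRule.subst]

@[simp] lemma subst_append (u : V → List T) (s t : List (T ⊕ V)) :
    MCFRule.subst u (s ++ t) = MCFRule.subst u s ++ MCFRule.subst u t := by
  simp [MCFRule.subst]

lemma map_fst_marked (u : V → List T) (s : List (T ⊕ V)) :
    (marked u s).map Prod.fst = MCFRule.subst u s := by
  induction s with
  | nil => rfl
  | cons e s ih => rcases e with t | x <;> simp [ih, Function.comp_def]

lemma countP_marked (u : V → List T) (s : List (T ⊕ V)) :
    (marked u s).countP (fun p => p.2) = weight u s := by
  induction s with
  | nil => rfl
  | cons e s ih => rcases e with t | x <;> simp [ih, List.countP_map, Function.comp_def]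

lemma length_subst_add (u u' : V → List T) (s : List (T ⊕ V)) :
    (MCFRule.subst u s).length + weight u' s = (MCFRule.subst u' s).length + weight u s := by
  induction s with
  | nil => rfl
  | cons e s ih => rcases e with t | x <;> simp <;> omega

lemma length_subst_le (u : V → List T) (s : List (T ⊕ V)) :
    (MCFRule.subst u s).length ≤ s.length + weight u s := by
  induction s with
  | nil => simp
  | cons e s ih => rcases e with t | x <;> simp <;> omega

/-- Summing a function over a list without repetitions gives at most its sum over the type. -/
lemma sum_map_le_of_nodup [Fintype V] (f : V → ℕ) {l : List V} (hl : l.Nodup) :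
    (l.map f).sum ≤ ∑ x, f x := by
  classical
  rw [← List.sum_toFinset f hl]
  exact Finset.sum_le_sum_of_subset (Finset.subset_univ _)

/-! ### Letters from the context and letters from the substituted words -/

/-- The number of positions at which a list of booleans changes its value. -/
def changes : List Bool → ℕ
  | a :: b :: l => (if a = b then 0 else 1) + changes (b :: l)
  | _ => 0

lemma changes_cons_le (b : Bool) (l : List Bool) : changes (b :: l) ≤ 1 + changes l := by
  cases l with
  | nil => simp [changes]
  | cons c l => simp only [changes]; split_ifs <;> omega

lemma changes_le_cons (b : Bool) (l : List Bool) : changes l ≤ changes (b :: l) := by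
  cases l with
  | nil => simp [changes]
  | cons c l => simp [changes]

lemma changes_cons_self (b : Bool) (l : List Bool) : changes (b :: b :: l) = changes (b :: l) := by
  simp [changes]

lemma changes_add_le (l₁ l₂ : List Bool) : changes l₁ + changes l₂ ≤ changes (l₁ ++ l₂) := by
  induction l₁ with
  | nil => simp [changes]
  | cons a l ih =>
    cases l with
    | nil => simpa [changes] using changes_le_cons a l₂
    | cons b l =>
      simp only [List.cons_append, changes] at ih ⊢
      omega

lemma eq_head_of_changes_eq_zero (a : Bool) (l : List Bool) (h : changes (a :: l) = 0) :
    ∀ b ∈ l, b = a := by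
  induction l with
  | nil => simp
  | cons c l ih =>
    simp only [changes, Nat.add_eq_zero_iff] at h
    have hac : a = c := by by_contra hne; simp [hne] at h
    subst hac
    simpa using ih h.2

lemma changes_replicate_true_append (n : ℕ) (l : List Bool) :
    changes (false :: (List.replicate n true ++ l)) ≤ 2 + changes (false :: l) := by
  induction n with
  | zero => simp
  | succ n ih =>
    cases n with
    | zero =>
      have h₁ := changes_cons_le false (true :: l)
      have h₂ := changes_cons_le true l
      have h₃ := changes_le_cons false l
      simp only [List.replicate, List.cons_append, List.nil_append]
      omega
    | succ n =>
      simp only [List.replicate, List.cons_append] at ih ⊢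
      rwa [changes, changes_cons_self, ← changes]

/-- Each variable contributes at most two changes between context and substituted words. -/
lemma changes_marked_le (u : V → List T) (s : List (T ⊕ V)) :
    changes (false :: (marked u s).map Prod.snd) ≤ 2 * (vars s).length := by
  induction s with
  | nil => simp [changes]
  | cons e s ih =>
    rcases e with t | x
    · simpa [changes_cons_self] using ih
    · have := changes_replicate_true_append (u x).length ((marked u s).map Prod.snd)
      simp only [marked_inr, List.map_append, List.map_map, Function.comp_def, List.map_const',
        vars_inr, List.length_cons]
      omega

/-- If a marked word is cut into more blocks than its marks change, then some block carries only
one mark. -/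
lemma exists_constant_block (Bs : List (List T)) (τ : List (T × Bool))
    (h : τ.map Prod.fst = Bs.flatten) (hc : changes (τ.map Prod.snd) < Bs.length) :
    ∃ B ∈ Bs, ∃ X Z Y, τ = X ++ Z ++ Y ∧ Z.map Prod.fst = B ∧ ∃ b, ∀ p ∈ Z, p.2 = b := by
  induction Bs generalizing τ with
  | nil => simp at hc
  | cons B Bs ih =>
    rw [List.flatten_cons, List.map_eq_append_iff] at h
    obtain ⟨Z, Y, rfl, hZ, hY⟩ := h
    by_cases hz : changes (Z.map Prod.snd) = 0
    · refine ⟨B, by simp, [], Z, Y, by simp, hZ, ?_⟩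
      cases Z with
      | nil => exact ⟨true, by simp⟩
      | cons p Z =>
        refine ⟨p.2, ?_⟩
        have := eq_head_of_changes_eq_zero p.2 (Z.map Prod.snd) hz
        intro q hq
        rcases List.mem_cons.1 hq with rfl | hq
        · rfl
        · exact this _ (List.mem_map_of_mem hq)
    · have hle := changes_add_le (Z.map Prod.snd) (Y.map Prod.snd)
      rw [List.map_append] at hc
      obtain ⟨B', hB', X', Z', Y', rfl, h₁, h₂⟩ := ih Y hY (by simp at hc; omega)
      exact ⟨B', by simp [hB'], Z ++ X', Z', Y', by simp, h₁, h₂⟩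

lemma exists_prefix_of_marked_eq (u : V → List T) (s : List (T ⊕ V)) (B Y : List (T × Bool))
    (hB : ∀ p ∈ B, p.2 = false) (h : marked u s = B ++ Y) :
    ∃ s₀ s₂, s = s₀ ++ s₂ ∧ marked u s₀ = B := by
  induction s generalizing B with
  | nil => exact ⟨[], [], rfl, by simp at h; simp [h]⟩
  | cons e s ih =>
    cases B with
    | nil => exact ⟨[], e :: s, rfl, rfl⟩
    | cons p B =>
      rcases e with t | x
      · simp only [marked_inl, List.cons_append, List.cons.injEq] at h
        obtain ⟨s₀, s₂, rfl, hs⟩ := ih B (fun q hq => hB q (by simp [hq])) h.2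
        exact ⟨Sum.inl t :: s₀, s₂, rfl, by simp [hs, h.1]⟩
      · cases hx : u x with
        | nil =>
          obtain ⟨s₀, s₂, rfl, hs⟩ := ih (p :: B) hB (by simpa [hx] using h)
          exact ⟨Sum.inr x :: s₀, s₂, rfl, by simp [hs, hx]⟩
        | cons t l =>
          have hp := hB p (by simp)
          simp only [marked_inr, hx, List.map_cons, List.cons_append, List.cons.injEq] at h
          simp [← h.1] at hp

/-- A factor of the marked word that comes from the context alone is cut out by a factor of the
context. -/
lemma exists_infix_of_marked_eq (u : V → List T) (s : List (T ⊕ V)) (X B Y : List (T × Bool))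
    (hB : ∀ p ∈ B, p.2 = false) (h : marked u s = X ++ B ++ Y) :
    ∃ s₁ s₀ s₂, s = s₁ ++ s₀ ++ s₂ ∧ marked u s₀ = B := by
  induction s generalizing X with
  | nil => exact ⟨[], [], [], rfl, by simp at h; simp [h]⟩
  | cons e s ih =>
    rcases e with t | x
    · cases X with
      | nil =>
        obtain ⟨s₀, s₂, h₁, h₂⟩ := exists_prefix_of_marked_eq u (Sum.inl t :: s) B Y hB h
        exact ⟨[], s₀, s₂, by simpa using h₁, h₂⟩
      | cons p X =>
        simp only [marked_inl, List.cons_append, List.cons.injEq] at h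
        obtain ⟨s₁, s₀, s₂, rfl, h₂⟩ := ih X h.2
        exact ⟨Sum.inl t :: s₁, s₀, s₂, rfl, h₂⟩
    · rw [marked_inr, List.append_assoc, List.append_eq_append_iff] at h
      rcases h with ⟨X', rfl, h⟩ | ⟨l, hl, h⟩
      · obtain ⟨s₁, s₀, s₂, rfl, h₂⟩ := ih X' (by simpa using h)
        exact ⟨Sum.inr x :: s₁, s₀, s₂, rfl, h₂⟩
      · cases l with
        | nil =>
          obtain ⟨s₀, s₂, rfl, h₂⟩ := exists_prefix_of_marked_eq u s B Y hB (by simpa using h.symm)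
          exact ⟨[Sum.inr x], s₀, s₂, rfl, h₂⟩
        | cons p l =>
          cases B with
          | nil => exact ⟨[], [], Sum.inr x :: s, rfl, rfl⟩
          | cons q B =>
            have hq := hB q (by simp)
            have hp : p ∈ (u x).map fun t => (t, true) := by rw [hl]; simp
            obtain ⟨t, -, rfl⟩ := List.mem_map.1 hp
            simp only [List.cons_append, List.cons.injEq] at h
            simp [h.1] at hq

/-! ### Contexts of the children of a rule -/

/-- The string obtained from `s` by putting strings of terminals and variables for its
variables. -/
def compose (o : V → List (T ⊕ W)) (s : List (T ⊕ V)) : List (T ⊕ W) :=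
  s.flatMap (Sum.elim (fun t => [Sum.inl t]) o)

@[simp] lemma compose_nil (o : V → List (T ⊕ W)) : compose o [] = [] := rfl

@[simp] lemma compose_inl (o : V → List (T ⊕ W)) (t : T) (s : List (T ⊕ V)) :
    compose o (Sum.inl t :: s) = Sum.inl t :: compose o s := rfl

@[simp] lemma compose_inr (o : V → List (T ⊕ W)) (x : V) (s : List (T ⊕ V)) :
    compose o (Sum.inr x :: s) = o x ++ compose o s := by
  simp [compose]

lemma subst_compose (o : V → List (T ⊕ W)) (v : W → List T) (s : List (T ⊕ V)) :
    MCFRule.subst v (compose o s) = MCFRule.subst (fun x => MCFRule.subst v (o x)) s := by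
  induction s with
  | nil => rfl
  | cons e s ih => rcases e with t | x <;> simp [ih]

lemma vars_compose (o : V → List (T ⊕ W)) (s : List (T ⊕ V)) :
    vars (compose o s) = (vars s).flatMap fun x => vars (o x) := by
  induction s with
  | nil => rfl
  | cons e s ih => rcases e with t | x <;> simp [ih]

lemma weight_le_weight_compose (o : V → List (T ⊕ W)) (v : W → List T) (s : List (T ⊕ V)) :
    weight (fun x => MCFRule.subst v (o x)) s ≤
      ((vars s).map fun x => (o x).length).sum + weight v (compose o s) := by
  induction s with
  | nil => simp
  | cons e s ih =>
    rcases e with t | x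
    · simpa using ih
    · have := length_subst_le v (o x)
      have h : weight v (o x ++ compose o s) = weight v (o x) + weight v (compose o s) := by
        simp [weight]
      simp only [weight_inr, compose_inr, vars_inr, List.map_cons, List.sum_cons, h]
      omega

variable {ι : Type*} [DecidableEq ι] {κ : ι → Type*}

/-- The variable `x` of the `i`-th family if it belongs to it. -/
def component (i : ι) (x : Σ i, κ i) : Option (κ i) :=
  if h : x.1 = i then some (h ▸ x.2) else none

@[simp] lemma component_self (i : ι) (y : κ i) : component i ⟨i, y⟩ = some y := by
  simp [component]

lemma component_of_ne {i j : ι} (h : j ≠ i) (y : κ j) : component i ⟨j, y⟩ = none := by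
  simp [component, h]

lemma component_eq_some {i : ι} {x : Σ i, κ i} {y : κ i} :
    component i x = some y ↔ x = ⟨i, y⟩ := by
  obtain ⟨j, z⟩ := x
  by_cases h : j = i
  · subst h; simp
  · simp only [component_of_ne h, reduceCtorEq, false_iff]
    intro hx
    exact h (congrArg Sigma.fst hx)

/-- The string obtained from `s` by putting the words `v` for all variables outside the `i`-th
family. -/
def restrict (i : ι) (v : ∀ i, κ i → List T) (s : List (T ⊕ Σ i, κ i)) : List (T ⊕ κ i) :=
  s.flatMap (Sum.elim (fun t => [Sum.inl t]) fun x =>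
    (component i x).elim ((v x.1 x.2).map Sum.inl) fun y => [Sum.inr y])

@[simp] lemma restrict_inl (i : ι) (v : ∀ i, κ i → List T) (t : T) (s : List (T ⊕ Σ i, κ i)) :
    restrict i v (Sum.inl t :: s) = Sum.inl t :: restrict i v s := rfl

@[simp] lemma restrict_inr_self (i : ι) (v : ∀ i, κ i → List T) (y : κ i)
    (s : List (T ⊕ Σ i, κ i)) :
    restrict i v (Sum.inr ⟨i, y⟩ :: s) = Sum.inr y :: restrict i v s := by
  simp [restrict]

lemma restrict_inr_of_ne {i j : ι} (h : j ≠ i) (v : ∀ i, κ i → List T) (y : κ j)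
    (s : List (T ⊕ Σ i, κ i)) :
    restrict i v (Sum.inr ⟨j, y⟩ :: s) = (v j y).map Sum.inl ++ restrict i v s := by
  simp [restrict, component_of_ne h]

lemma subst_map_inl (u : V → List T) (l : List T) :
    MCFRule.subst u (l.map Sum.inl) = l := by
  induction l with
  | nil => rfl
  | cons t l ih => simp [ih]

lemma vars_map_inl (l : List T) : vars (l.map Sum.inl : List (T ⊕ V)) = [] := by
  induction l with
  | nil => rfl
  | cons t l ih => simp [ih]

lemma subst_restrict (i : ι) (v : ∀ i, κ i → List T) (w : κ i → List T)
    (s : List (T ⊕ Σ i, κ i)) :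
    MCFRule.subst w (restrict i v s) =
      MCFRule.subst (fun x => Function.update v i w x.1 x.2) s := by
  induction s with
  | nil => rfl
  | cons e s ih =>
    rcases e with t | ⟨j, y⟩
    · simp [ih]
    · by_cases h : j = i
      · subst h; simp [ih]
      · simp [restrict_inr_of_ne h, ih, subst_map_inl, Function.update_of_ne h]

lemma vars_restrict (i : ι) (v : ∀ i, κ i → List T) (s : List (T ⊕ Σ i, κ i)) :
    vars (restrict i v s) = (vars s).filterMap (component i) := by
  induction s with
  | nil => rfl
  | cons e s ih =>
    rcases e with t | ⟨j, y⟩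
    · simp [ih]
    · by_cases h : j = i
      · subst h; simp [ih]
      · simp [restrict_inr_of_ne h, ih, vars_map_inl, component_of_ne h]

lemma weight_eq_sum_weight_restrict [Fintype ι] (v : ∀ i, κ i → List T)
    (s : List (T ⊕ Σ i, κ i)) :
    weight (fun x => v x.1 x.2) s = ∑ i, weight (v i) (restrict i v s) := by
  simp only [weight, vars_restrict]
  induction vars s with
  | nil => simp
  | cons x l ih =>
    obtain ⟨j, y⟩ := x
    have h : ∀ i, (((⟨j, y⟩ :: l : List (Σ i, κ i)).filterMap (component i)).map
        fun x => (v i x).length).sum = (if i = j then (v j y).length else 0) +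
          ((l.filterMap (component i)).map fun x => (v i x).length).sum := by
      intro i
      by_cases hij : i = j
      · subst hij; simp
      · simp [component_of_ne (Ne.symm hij), hij]
    simp only [h, Finset.sum_add_distrib, ← ih]
    simp

lemma nodup_vars_restrict (i : ι) (v : ∀ i, κ i → List T) {s : List (T ⊕ Σ i, κ i)}
    (hs : (vars s).Nodup) : (vars (restrict i v s)).Nodup := by
  rw [vars_restrict]
  refine hs.filterMap fun x y z hx hy => ?_
  rw [Option.mem_def, component_eq_some] at hx hy
  rw [hx, hy]

lemma nodup_vars_compose {n : ℕ} {o : Fin n → List (T ⊕ W)} {s : List (T ⊕ Fin n)}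
    (hs : (vars s).Nodup) (ho : ((List.ofFn o).flatten.filterMap Sum.getRight?).Nodup) :
    (vars (compose o s)).Nodup := by
  have ho' : ((List.finRange n).flatMap fun j => vars (o j)).Nodup := by
    rw [List.filterMap_flatten, List.ofFn_eq_map, List.map_map] at ho
    exact ho
  rw [List.nodup_flatMap] at ho'
  rw [vars_compose, List.nodup_flatMap]
  refine ⟨fun x _ => ho'.1 x (List.mem_finRange x), ?_⟩
  have hd : ∀ x y : Fin n, x ≠ y → List.Disjoint (vars (o x)) (vars (o y)) := by
    intro x y hxy
    have : Std.Symm (Function.onFun List.Disjoint fun j => vars (o j)) :=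
      ⟨fun _ _ h => List.Disjoint.symm h⟩
    exact ho'.2.forall (List.mem_finRange x) (List.mem_finRange y) hxy
  exact hs.imp fun h => hd _ _ h

end LinearContext

/-! ### The words `(a^m b^m)^n` -/

/-- The word `(a^m b^m)^n`. -/
def blockWord (m n : ℕ) : List AB :=
  (List.replicate n (List.replicate m AB.a ++ List.replicate m AB.b)).flatten

namespace blockWord

open LinearContext

lemma mem_languageL1 {m n : ℕ} (hm : 1 ≤ m) (hn : 1 ≤ n) : blockWord m n ∈ languageL1 :=
  ⟨m, n, hm, hn, rfl⟩

lemma zero (m : ℕ) : blockWord m 0 = [] := rfl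

lemma succ (m n : ℕ) : blockWord m (n + 1) =
    List.replicate m AB.a ++ (List.replicate m AB.b ++ blockWord m n) := by
  simp [blockWord, List.replicate_succ]

lemma length (m n : ℕ) : (blockWord m n).length = n * (2 * m) := by
  induction n with
  | zero => simp [zero]
  | succ n ih => simp only [succ, List.length_append, List.length_replicate, ih]; ring

lemma count (m n : ℕ) (x : AB) : (blockWord m n).count x = n * m := by
  induction n with
  | zero => simp [zero]
  | succ n ih => cases x <;> simp [succ, ih, List.count_replicate] <;> ring

/-- The blocks `a^m` and `b^m` of `(a^m b^m)^n`, in order. -/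
def blocks (m n : ℕ) : List (List AB) :=
  (List.replicate n [List.replicate m AB.a, List.replicate m AB.b]).flatten

lemma length_blocks (m n : ℕ) : (blocks m n).length = 2 * n := by
  simp [blocks, mul_comm]

lemma flatten_blocks (m n : ℕ) : (blocks m n).flatten = blockWord m n := by
  induction n with
  | zero => rfl
  | succ n ih =>
    have : blocks m (n + 1) = List.replicate m AB.a :: List.replicate m AB.b :: blocks m n := by
      simp [blocks, List.replicate_succ]
    rw [this, succ, List.flatten_cons, List.flatten_cons, ih]

lemma eq_replicate_of_mem_blocks {m n : ℕ} {B : List AB} (h : B ∈ blocks m n) :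
    ∃ c, B = List.replicate m c := by
  simp only [blocks, List.mem_flatten] at h
  obtain ⟨l, hl, hB⟩ := h
  rw [List.eq_of_mem_replicate hl] at hB
  simp only [List.mem_cons, List.not_mem_nil, or_false] at hB
  rcases hB with rfl | rfl
  exacts [⟨_, rfl⟩, ⟨_, rfl⟩]

/-- The letter at position `i` is determined by the residue of `i` modulo `2 * m`. -/
lemma getElem?_eq (m n i : ℕ) (hi : i < n * (2 * m)) :
    (blockWord m n)[i]? = some (if i % (2 * m) < m then AB.a else AB.b) := by
  induction n generalizing i with
  | zero => simp at hi
  | succ n ih =>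
    rw [succ]
    by_cases h₁ : i < m
    · rw [List.getElem?_append_left (by simpa using h₁), Nat.mod_eq_of_lt (by omega)]
      simp [h₁]
    · rw [List.getElem?_append_right (by simpa using h₁), List.length_replicate]
      by_cases h₂ : i < 2 * m
      · rw [List.getElem?_append_left (by simp; omega), Nat.mod_eq_of_lt h₂, if_neg h₁,
          List.getElem?_replicate, if_pos (by omega)]
      · rw [List.getElem?_append_right (by simp; omega), List.length_replicate]
        have : i - m - m = i - 2 * m := by omega
        rw [this, ih _ (by rw [add_mul] at hi; omega), ← Nat.mod_eq_sub_mod (by omega)]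

/-- A constant factor of `(a^m b^m)^n` has length at most `m`. -/
lemma le_of_infix {m n l : ℕ} {c : AB} {X Y : List AB}
    (h : blockWord m n = X ++ List.replicate l c ++ Y) : l ≤ m := by
  by_contra! hlt
  have hlen := congrArg List.length h
  simp only [length, List.length_append, List.length_replicate] at hlen
  have key : ∀ i < l, (blockWord m n)[X.length + i]? = some c := by
    intro i hi
    rw [h, List.append_assoc, List.getElem?_append_right (by omega),
      List.getElem?_append_left (by simp; omega)]
    simp [hi]
  have hm : 0 < m := by
    rcases Nat.eq_zero_or_pos m with rfl | hm
    · simp at hlen; omega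
    · exact hm
  -- Positions at distance `m` carry different letters.
  have h₀ := key 0 (by omega)
  have h₁ := key m hlt
  rw [getElem?_eq _ _ _ (by omega)] at h₀ h₁
  have hmod : (X.length + m) % (2 * m) =
      if X.length % (2 * m) < m then X.length % (2 * m) + m else X.length % (2 * m) - m := by
    have hr := Nat.mod_lt X.length (show 0 < 2 * m by omega)
    rw [Nat.add_mod, Nat.mod_eq_of_lt (show m < 2 * m by omega)]
    split_ifs with hc
    · exact Nat.mod_eq_of_lt (by omega)
    · rw [Nat.mod_eq_sub_mod (by omega), Nat.mod_eq_of_lt (by omega)]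
      omega
  rw [add_zero] at h₀
  rw [hmod] at h₁
  have hr := Nat.mod_lt X.length (show 0 < 2 * m by omega)
  rw [← h₀] at h₁
  by_cases hc : X.length % (2 * m) < m
  · simp [hc] at h₁
  · have : X.length % (2 * m) - m < m := by omega
    simp [hc, this] at h₁

/-! ### A finite automaton counting the blocks -/

/-- Transition of the automaton that stores whether the last letter was `a`, and the number of
factors `ab` read so far modulo `N`. -/
def step (N : ℕ) : Bool × ZMod N → AB → Bool × ZMod N
  | (_, c), AB.a => (true, c)
  | (p, c), AB.b => (false, if p then c + 1 else c)

lemma foldl_step_replicate_a (N m : ℕ) (p : Bool) (c : ZMod N) :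
    (List.replicate (m + 1) AB.a).foldl (step N) (p, c) = (true, c) := by
  induction m generalizing p with
  | zero => rfl
  | succ m ih => rw [List.replicate_succ, List.foldl_cons]; exact ih true

lemma foldl_step_replicate_b (N m : ℕ) (c : ZMod N) :
    (List.replicate m AB.b).foldl (step N) (false, c) = (false, c) := by
  induction m with
  | zero => rfl
  | succ m ih => rw [List.replicate_succ, List.foldl_cons]; exact ih

lemma foldl_step (N m n : ℕ) (hm : 1 ≤ m) (c : ZMod N) :
    (blockWord m n).foldl (step N) (false, c) = (false, c + n) := by
  obtain ⟨m, rfl⟩ := Nat.exists_eq_add_of_le' hm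
  induction n generalizing c with
  | zero => simp [zero]
  | succ n ih =>
    rw [succ, List.foldl_append, foldl_step_replicate_a, List.foldl_append, List.replicate_succ,
      List.foldl_cons]
    have : step N (true, c) AB.b = (false, c + 1) := rfl
    rw [this, foldl_step_replicate_b, ih]
    congr 1
    push_cast
    ring

/-- What is remembered of a word: its action on the states of the automaton, and whether it is
empty. -/
def profile (N : ℕ) (u : List AB) : (Bool × ZMod N → Bool × ZMod N) × Bool :=
  (u.foldl (step N), u.isEmpty)

variable {V : Type*}

lemma foldl_step_subst_congr (N : ℕ) {u u' : V → List AB}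
    (h : ∀ x, profile N (u x) = profile N (u' x)) (s : List (AB ⊕ V)) (q : Bool × ZMod N) :
    (MCFRule.subst u s).foldl (step N) q = (MCFRule.subst u' s).foldl (step N) q := by
  induction s generalizing q with
  | nil => rfl
  | cons e s ih =>
    rcases e with t | x
    · simp [ih]
    · have hx : (u x).foldl (step N) q = (u' x).foldl (step N) q :=
        congrFun (congrArg Prod.fst (h x)) q
      simp [List.foldl_append, hx, ih]

/-! ### Contexts containing a whole block -/

/-- The context `s`, filled with `u`, contains a whole block of length `m`: some factor of `s` is
turned into `a^m` or `b^m` while its variables are given empty words. -/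
def ContainsBlock (m : ℕ) (u : V → List AB) (s : List (AB ⊕ V)) : Prop :=
  ∃ s₁ s₀ s₂, s = s₁ ++ s₀ ++ s₂ ∧ ∃ c, marked u s₀ = List.replicate m (c, false)

lemma marked_congr_of_isEmpty {u u' : V → List AB} (h : ∀ x, (u x).isEmpty = (u' x).isEmpty)
    (s : List (AB ⊕ V)) (hs : ∀ p ∈ marked u s, p.2 = false) : marked u' s = marked u s := by
  induction s with
  | nil => rfl
  | cons e s ih =>
    rcases e with t | x
    · simp only [marked_inl, List.mem_cons, forall_eq_or_imp] at hs ⊢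
      rw [ih hs.2]
    · have hx : u x = [] := by
        cases hux : u x with
        | nil => rfl
        | cons t l => simpa [hux] using hs (t, true) (by simp [hux])
      have hx' : u' x = [] := by simpa [hx] using (h x).symm
      simp only [marked_inr, hx, hx', List.map_nil, List.nil_append] at hs ⊢
      exact ih hs

/-- If a word `(a^m b^m)^n` is filled into a context with fewer than `n` variables, then the context
contains a whole block, or the substituted words do. -/
lemma containsBlock_or_le_weight {m n : ℕ} {u : V → List AB} {s : List (AB ⊕ V)}
    (h : MCFRule.subst u s = blockWord m n) (hs : (vars s).length < n) :
    ContainsBlock m u s ∨ m ≤ weight u s := by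
  have hch := (changes_le_cons _ _).trans (changes_marked_le u s)
  obtain ⟨B, hB, X, Z, Y, hτ, hZ, b, hb⟩ := exists_constant_block (blocks m n) (marked u s)
    (by rw [map_fst_marked, h, flatten_blocks]) (by rw [length_blocks]; omega)
  obtain ⟨c, rfl⟩ := eq_replicate_of_mem_blocks hB
  have hlen : Z.length = m := by simpa using congrArg List.length hZ
  cases b with
  | false =>
    obtain ⟨s₁, s₀, s₂, rfl, h₀⟩ := exists_infix_of_marked_eq u s X Z Y hb hτ
    refine Or.inl ⟨s₁, s₀, s₂, rfl, c, h₀.trans (List.eq_replicate_iff.2 ⟨hlen, fun p hp => ?_⟩)⟩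
    have : p.1 ∈ List.replicate m c := hZ ▸ List.mem_map_of_mem hp
    exact Prod.ext (List.eq_of_mem_replicate this) (hb p hp)
  | true =>
    right
    rw [← countP_marked, hτ, List.countP_append, List.countP_append,
      List.countP_eq_length.2 hb]
    omega

/-- Exchange argument: filling a context that contains a whole block with words of the same
profiles can neither shorten the blocks nor reduce their number, if the result stays in the
language. Hence the new words are at least as long in total. -/
lemma weight_le_of_containsBlock {m n : ℕ} (hm : 1 ≤ m) {u u' : V → List AB} {s : List (AB ⊕ V)}
    (h : MCFRule.subst u s = blockWord m n) (h' : MCFRule.subst u' s ∈ languageL1)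
    (hp : ∀ x, profile (n + 1) (u x) = profile (n + 1) (u' x)) (hs : ContainsBlock m u s) :
    weight u s ≤ weight u' s := by
  obtain ⟨m', n', hm', -, hw : MCFRule.subst u' s = blockWord m' n'⟩ := h'
  have hn : n ≤ n' := by
    have := foldl_step_subst_congr (n + 1) hp s (false, 0)
    rw [h, hw, foldl_step _ _ _ hm, foldl_step _ _ _ hm'] at this
    simp only [zero_add, Prod.mk.injEq, true_and] at this
    rw [ZMod.natCast_eq_natCast_iff', Nat.mod_eq_of_lt (Nat.lt_succ_self n)] at this
    exact this ▸ Nat.mod_le _ _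
  have hmm : m ≤ m' := by
    obtain ⟨s₁, s₀, s₂, rfl, c, hc⟩ := hs
    have h₀ : MCFRule.subst u' s₀ = List.replicate m c := by
      rw [← map_fst_marked, marked_congr_of_isEmpty (fun x => congrArg Prod.snd (hp x)) s₀, hc]
      · simp
      · intro p hp
        rw [hc] at hp
        rw [List.eq_of_mem_replicate hp]
    rw [subst_append, subst_append, h₀] at hw
    exact le_of_infix hw.symm
  have hlen := length_subst_add u u' s
  rw [h, hw, length, length] at hlen
  have : n * (2 * m) ≤ n' * (2 * m') := by gcongr
  omega

end blockWord

/-! ### Bounding the subtrees of a derivation -/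

namespace MCFGrammar

open LinearContext blockWord

/-- The string `s` is a context of the non-terminal `A` in `G`: its variables are distinct, and it
turns all values of `A` into words of `languageL1`. -/
def IsContext (G : MCFGrammar AB) (A : G.NT) (s : List (AB ⊕ Fin (G.rank A))) : Prop :=
  (vars s).Nodup ∧ ∀ u, G.Derives A u → MCFRule.subst u s ∈ languageL1

/-- By the exchange argument and because there are only finitely many profiles, words that are
derived inside a context containing a whole block have bounded length. -/
lemma exists_weight_bound (G : MCFGrammar AB) (n : ℕ) :
    ∃ C, ∀ m, 1 ≤ m → ∀ A s u, G.IsContext A s → G.Derives A u →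
      MCFRule.subst u s = blockWord m n → ContainsBlock m u s → weight u s ≤ C := by
  have := G.finite_NT
  let P := Σ A : G.NT, Fin (G.rank A) →
    (Bool × ZMod (n + 1) → Bool × ZMod (n + 1)) × Bool
  have key : ∀ p : P, ∃ C, ∀ m, 1 ≤ m → ∀ s u, G.IsContext p.1 s → G.Derives p.1 u →
      (fun x => profile (n + 1) (u x)) = p.2 →
      MCFRule.subst u s = blockWord m n → ContainsBlock m u s → weight u s ≤ C := by
    intro p
    by_cases hp : ∃ u', G.Derives p.1 u' ∧ (fun x => profile (n + 1) (u' x)) = p.2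
    · obtain ⟨u', hu', hp'⟩ := hp
      refine ⟨∑ x, (u' x).length, fun m hm s u hs _ hpu hw hc => ?_⟩
      exact (weight_le_of_containsBlock hm hw (hs.2 u' hu')
        (fun x => congrFun (hpu.trans hp'.symm) x) hc).trans (sum_map_le_of_nodup _ hs.1)
    · exact ⟨0, fun m _ s u _ hu hpu _ _ => absurd ⟨u, hu, hpu⟩ hp⟩
  choose C hC using key
  obtain ⟨M, hM⟩ := (Set.finite_range C).bddAbove
  refine ⟨M, fun m hm A s u hs hu hw hc => ?_⟩
  exact (hC ⟨A, fun x => profile (n + 1) (u x)⟩ m hm s u hs hu rfl hw hc).trans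
    (hM (Set.mem_range_self _))

/-- The context of the `i`-th child in an application of the rule `r`, the other children having
the values `v`. -/
lemma IsContext.child {G : MCFGrammar AB} {r : MCFRule AB G.rank} (hr : r ∈ G.rules)
    {v : (i : Fin r.arity) → Fin (G.rank (r.rhs i)) → List AB}
    (hv : ∀ i, G.Derives (r.rhs i) (v i)) {s : List (AB ⊕ Fin (G.rank r.lhs))}
    (hs : G.IsContext r.lhs s) (i : Fin r.arity) :
    G.IsContext (r.rhs i) (restrict i v (compose r.out s)) := by
  refine ⟨nodup_vars_restrict i v (nodup_vars_compose hs.1 r.linear), fun w hw => ?_⟩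
  rw [subst_restrict (κ := fun i => Fin (G.rank (r.rhs i))), subst_compose]
  refine hs.2 _ (Derives.rule r hr (Function.update v i w) fun j => ?_)
  by_cases h : j = i
  · subst h; simpa using hw
  · simpa [Function.update_of_ne h] using hv j

/-- Every subtree of a derivation of `(a^m b^m)^n` with `m` large has a context that contains a
whole block. Otherwise, consider a lowest subtree violating this: its children yield words of
bounded length, so it yields words of bounded length, but it has to yield a whole block. -/
lemma containsBlock_of_derives {G : MCFGrammar AB} {k C m n : ℕ} (hk : ∀ A, G.rank A ≤ k)
    (hn : k < n) (hC : ∀ A s u, G.IsContext A s → G.Derives A u →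
      MCFRule.subst u s = blockWord m n → ContainsBlock m u s → weight u s ≤ C)
    (hm : ∀ r ∈ G.rules, (∑ j, (r.out j).length) + r.arity * C < m)
    {A : G.NT} {u : Fin (G.rank A) → List AB} (hu : G.Derives A u)
    {s : List (AB ⊕ Fin (G.rank A))} (hs : G.IsContext A s)
    (hw : MCFRule.subst u s = blockWord m n) : ContainsBlock m u s := by
  induction hu with
  | rule r hr v hv ih =>
    have hcard : (vars s).length ≤ G.rank r.lhs := by
      simpa using hs.1.length_le_card
    refine (containsBlock_or_le_weight hw
      ((hcard.trans (hk _)).trans_lt hn)).resolve_right fun hle => ?_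
    have hchild : ∀ i, weight (v i) (restrict i v (compose r.out s)) ≤ C := by
      intro i
      have hi := hs.child hr hv i
      have hwi : MCFRule.subst (v i) (restrict i v (compose r.out s)) = blockWord m n := by
        rw [subst_restrict (κ := fun i => Fin (G.rank (r.rhs i))), subst_compose,
          Function.update_eq_self]
        exact hw
      exact hC _ _ _ hi (hv i) hwi (ih i hi hwi)
    have h₁ := weight_le_weight_compose r.out (fun x => v x.1 x.2) s
    have h₂ := sum_map_le_of_nodup (fun j => (r.out j).length) hs.1
    have h₃ : weight (fun x => v x.1 x.2) (compose r.out s) ≤ r.arity * C := by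
      rw [weight_eq_sum_weight_restrict]
      simpa using Finset.sum_le_card_nsmul Finset.univ _ C fun i _ => hchild i
    have := hm r hr
    omega

lemma language_ne_languageL1 (G : MCFGrammar AB) {k : ℕ} (hk : ∀ A, G.rank A ≤ k) :
    G.language ≠ languageL1 := by
  intro hG
  obtain ⟨C, hC⟩ := G.exists_weight_bound (k + 1)
  obtain ⟨M, hM⟩ := (G.finite_rules.image
    fun r => (∑ j, (r.out j).length) + r.arity * C).bddAbove
  have hw : blockWord (M + 1) (k + 1) ∈ G.language :=
    hG ▸ mem_languageL1 (by omega) (by omega)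
  let x₀ : Fin (G.rank G.start) := ⟨0, by rw [G.rank_start]; exact Nat.one_pos⟩
  have hx : ∀ x, x = x₀ := fun x => Fin.ext (Nat.lt_one_iff.1 (x.2.trans_eq G.rank_start))
  have hroot : G.IsContext G.start [Sum.inr x₀] := by
    refine ⟨by simp, fun u hu => ?_⟩
    rw [← hG]
    have hu' : u = fun _ => u x₀ := funext fun x => by rw [hx x]
    rw [hu'] at hu
    simpa [language] using! hu
  have hc := containsBlock_of_derives hk (Nat.lt_succ_self k) (hC (M + 1) (by omega))
    (fun r hr => Nat.lt_succ_of_le (hM (Set.mem_image_of_mem _ hr))) hw hroot (by simp)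
  -- The context of the root consists of a single variable, so it contains no letters at all.
  obtain ⟨s₁, s₀, s₂, hs, c, h₀⟩ := hc
  have hmem : (c, false) ∈ marked (fun _ => blockWord (M + 1) (k + 1)) [Sum.inr x₀] := by
    rw [hs]
    simp only [marked, List.flatMap_append, List.mem_append] at h₀ ⊢
    left; right
    rw [h₀]
    simp
  simp at hmem

end MCFGrammar

/-! ### The Parikh image -/

lemma parikhImage_languageL1 : languageL1.parikhImage = {p | ∃ c : ℕ, p = fun _ => c + 1} := by
  ext p
  constructor
  · rintro ⟨w, ⟨m, n, hm, hn, hw⟩, rfl⟩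
    have hw : w = blockWord m n := hw
    have hpos : 0 < n * m := Nat.mul_pos hn hm
    refine ⟨n * m - 1, funext fun x => ?_⟩
    rw [parikh, hw, blockWord.count]
    omega
  · rintro ⟨c, rfl⟩
    refine ⟨_, blockWord.mem_languageL1 (m := c + 1) (n := 1) (by omega) le_rfl, funext fun x => ?_⟩
    rw [parikh, blockWord.count, one_mul]

lemma isLinearSet_parikhImage_languageL1 : IsLinearSet languageL1.parikhImage := by
  refine ⟨fun _ => 1, {fun _ => 1}, Set.finite_singleton _, ?_⟩
  rw [parikhImage_languageL1]
  ext p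
  simp only [Set.mem_ofPred_eq, Set.mem_vadd_set, SetLike.mem_coe,
    AddSubmonoid.mem_closure_singleton]
  constructor
  · rintro ⟨c, rfl⟩
    refine ⟨_, ⟨c, rfl⟩, funext fun x => ?_⟩
    simp [add_comm]
  · rintro ⟨_, ⟨c, rfl⟩, rfl⟩
    refine ⟨c, funext fun x => ?_⟩
    simp [add_comm]

theorem lemma5p2 :
    IsSemilinearSet languageL1.parikhImage ∧
    IsLinearSet languageL1.parikhImage ∧
    ¬ languageL1.IsMultipleContextFree := by
  refine ⟨isLinearSet_parikhImage_languageL1.isSemilinearSet,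
    isLinearSet_parikhImage_languageL1, ?_⟩
  rintro ⟨k, -, G, hk, hG⟩
  exact G.language_ne_languageL1 hk hG
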